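/- Let $R$ be a commutative principal ideal domain with field of fractions $Q$, and write $\operatorname{rank} M=\dim_Q(M\otimes_R Q)$. All chain complexes are complexes of $R$-modules concentrated in non-negative degrees. A real sequence $\mathbf a=(a_n)_{n\ge 0}$ for which $\sum a_nx^n$ has radius of convergence at least $1$ has Abel limit $L\in\mathbb R$ if $\lim_{x\to1^-}(1-x)\sum_n a_nx^n=L$, and is of controlled absolute growth if $\lim_{x\to1^-}(1-x)^2\sum_n |a_n|x^n=0$. Let $\mathcal C_A(R)$ be the category of chain complexes $C$ with all $\operatorname{rank}H_nC$ finite such that the sequence $\mathbf HC=((-1)^n\operatorname{rank}H_nC)_n$ has an Abel limit, denoted $\chi_A(C)$, and is of controlled absolute growth. Let $\mathfrak P(R)$ be the category of bounded chain complexes of finitely generated projective $R$-modules. Let $K_0^A(R)$ (respectively $K_0(R)$) be the abelian group generated by symbols $[C]$, one for each object $C$ of $\mathcal C_A(R)$ (respectively $\mathfrak P(R)$), subject to the relations $[A]=[A']$ whenever there is a quasi-isomorphism $A\to A'$, and $[B]=[A]+[C]$ for each short exact sequence $0\to A\to B\to C\to0$ of complexes with all three terms in the category. For a chain complex $C$ let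 $\Xi C=\bigoplus_{k\ge0}C[2k]$, where $C[2k]_n=C_{n-2k}$ (zero for $n<2k$). Then $\Xi C\in\mathcal C_A(R)$ for every $C\in\mathfrak P(R)$, and the assignments $[C]\mapsto[\Xi C]$, $[C]\mapsto\chi_A(C)$ and $[C]\mapsto\chi(C)=\sum_n(-1)^n\operatorname{rank}C_n=\sum_n(-1)^n\operatorname{rank}H_nC$ define group homomorphisms $$\xi_0\colon K_0(R)\to K_0^A(R),\qquad \chi_A\colon K_0^A(R)\to\mathbb R,\qquad \chi\colon K_0(R)\to\mathbb Z .$$ The composite $\chi_A\circ\xi_0\colon K_0(R)\to\mathbb R$ equals $\chi/2$, half of the classical Euler characteristic, and the map $\xi_0$ is injective. -/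

import Mathlib

open CategoryTheory CategoryTheory.Limits Filter Topology
open scoped TensorProduct

universe u

namespace AbelK

/-! ### Abel limits -/

/-- The power series `∑ a_k x^k` attached to a real sequence, as a function of `x`. -/
noncomputable def series (a : ℕ → ℝ) (x : ℝ) : ℝ := ∑' k : ℕ, a k * x ^ k

/-- The radius of convergence of `∑ a_k x^k` is at least one. -/
def RadiusGeOne (a : ℕ → ℝ) : Prop :=
  1 ≤ (FormalMultilinearSeries.ofScalars ℝ a).radius

/-- The sequence `a` has Abel limit `L`, that is, the radius of convergence is at least one and
`(1 - x) * ∑ a_k x^k → L` as `x → 1⁻`. -/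
def HasAbelLimit (a : ℕ → ℝ) (L : ℝ) : Prop :=
  RadiusGeOne a ∧ Tendsto (fun x : ℝ => (1 - x) * series a x) (𝓝[<] 1) (𝓝 L)

/-- An Abel sequence is a sequence with a (finite) Abel limit. -/
def IsAbelSequence (a : ℕ → ℝ) : Prop := ∃ L : ℝ, HasAbelLimit a L

/-- Controlled absolute growth: radius of convergence at least one, and
`(1 - x)^2 * ∑ |a_k| x^k → 0` as `x → 1⁻`. -/
def ControlledAbsoluteGrowth (a : ℕ → ℝ) : Prop :=
  RadiusGeOne a ∧
    Tendsto (fun x : ℝ => (1 - x) ^ 2 * series (fun k => |a k|) x) (𝓝[<] 1) (𝓝 0)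

/-! ### Ranks and Euler characteristics of chain complexes -/

section Complexes

variable (R : Type u) [CommRing R] [IsDomain R]

/-- The module `M` has finite rank: `Q ⊗ M` is finite-dimensional over the field of
fractions `Q` of `R`. -/
def FiniteRank (M : Type u) [AddCommGroup M] [Module R M] : Prop :=
  Module.Finite (FractionRing R) (FractionRing R ⊗[R] M)

/-- The rank of `M` is the dimension of `Q ⊗ M` over the field of fractions `Q` of `R`. -/
noncomputable def rank (M : Type u) [AddCommGroup M] [Module R M] : ℕ :=
  Module.finrank (FractionRing R) (FractionRing R ⊗[R] M)

variable {R}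

/-- The sequence `(-1)^n rank H_n C`. -/
noncomputable def homologySeq (C : ChainComplex (ModuleCat.{u} R) ℕ) (n : ℕ) : ℝ :=
  (-1) ^ n * (rank R (C.homology n) : ℝ)

/-- An Abel complex: all homology modules have finite rank, and `(-1)^n rank H_n C` is an
Abel sequence. -/
def IsAbelComplex (C : ChainComplex (ModuleCat.{u} R) ℕ) : Prop :=
  (∀ n, FiniteRank R (C.homology n)) ∧ IsAbelSequence (homologySeq C)

/-- The classical Euler characteristic `∑ (-1)^n rank C_n` computed from the chain modules. -/
noncomputable def eulerChar (C : ChainComplex (ModuleCat.{u} R) ℕ) : ℤ :=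
  ∑ᶠ n : ℕ, (-1) ^ n * (rank R (C.X n) : ℤ)

/-- The classical Euler characteristic `∑ (-1)^n rank H_n C` computed from homology. -/
noncomputable def homologyEulerChar (C : ChainComplex (ModuleCat.{u} R) ℕ) : ℤ :=
  ∑ᶠ n : ℕ, (-1) ^ n * (rank R (C.homology n) : ℤ)

variable (R)

/-- The objects of the category of Abel complexes of controlled absolute growth. -/
def abelComplexes : ObjectProperty (ChainComplex (ModuleCat.{u} R) ℕ) :=
  fun C => IsAbelComplex C ∧ ControlledAbsoluteGrowth (homologySeq C)

/-- Bounded (non-negative) chain complexes of finitely generated projective modules. -/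
def perfectComplexes : ObjectProperty (ChainComplex (ModuleCat.{u} R) ℕ) :=
  fun C => (∃ N : ℕ, ∀ n, N ≤ n → IsZero (C.X n)) ∧
    ∀ n, Module.Finite R (C.X n) ∧ Module.Projective R (C.X n)

end Complexes

/-! ### Grothendieck groups of categories of chain complexes -/

section K0

variable {R : Type u} [CommRing R]

/-- The defining relations of `K₀` of a full subcategory of chain complexes, in which the weak
equivalences are the quasi-isomorphisms and the cofibrations are the injective chain maps
(with quotient in the subcategory): `[A] = [A']` if there is a weak equivalence `A ⟶ A'`, and
`[B] = [A] + [C]` for each cofibration `A ↣ B` with quotient `C`, i.e. for each short exact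
sequence `0 ⟶ A ⟶ B ⟶ C ⟶ 0`. -/
def k0Relators (P : ObjectProperty (ChainComplex (ModuleCat.{u} R) ℕ)) :
    Set (FreeAbelianGroup P.FullSubcategory) :=
  {x | ∃ (A A' : P.FullSubcategory) (f : A.obj ⟶ A'.obj), QuasiIso f ∧
      x = FreeAbelianGroup.of A - FreeAbelianGroup.of A'} ∪
  {x | ∃ (A B C : P.FullSubcategory) (i : A.obj ⟶ B.obj) (p : B.obj ⟶ C.obj) (w : i ≫ p = 0),
      (ShortComplex.mk i p w).ShortExact ∧
      x = FreeAbelianGroup.of B - (FreeAbelianGroup.of A + FreeAbelianGroup.of C)}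

/-- `K₀` of a full subcategory of chain complexes: the abelian group generated by the symbols
`[A]`, one for each object, subject to the relations above. -/
abbrev K0 (P : ObjectProperty (ChainComplex (ModuleCat.{u} R) ℕ)) : Type (u + 1) :=
  FreeAbelianGroup P.FullSubcategory ⧸ AddSubgroup.closure (k0Relators P)

/-- The class `[A]` in `K₀` of a complex `A` in the subcategory. -/
def K0.cls {P : ObjectProperty (ChainComplex (ModuleCat.{u} R) ℕ)}
    (A : ChainComplex (ModuleCat.{u} R) ℕ) (hA : P A) : K0 P :=
  QuotientAddGroup.mk (FreeAbelianGroup.of ⟨A, hA⟩)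

end K0

/-- The algebraic `K`-group `K₀(R)`, as `K₀` of the category of bounded chain complexes of
finitely generated projective modules. -/
abbrev K0Ring (R : Type u) [CommRing R] : Type (u + 1) :=
  K0 (perfectComplexes R)

/-- The Abel method `K`-group `K₀ᴬ(R)`. -/
abbrev K0Abel (R : Type u) [CommRing R] [IsDomain R] : Type (u + 1) :=
  K0 (abelComplexes R)

/-! ### The functor `Ξ` -/

/-- The embedding of index sets `n ↦ n + m`. -/
def shiftEmbedding (m : ℕ) : (ComplexShape.down ℕ).Embedding (ComplexShape.down ℕ) where
  f n := n + m
  injective_f := fun a b h => by simpa using h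
  rel := by
    intro a b h
    simp only [ComplexShape.down_Rel] at h ⊢
    omega

/-- The functor `C ↦ C[m]` with `C[m]_{n + m} = C_n` and `C[m]_j = 0` for `j < m`
(used for even `m` only, where the shifted differential carries no sign). -/
noncomputable def shift (R : Type u) [CommRing R] (m : ℕ) :
    ChainComplex (ModuleCat.{u} R) ℕ ⥤ ChainComplex (ModuleCat.{u} R) ℕ :=
  (shiftEmbedding m).extendFunctor (ModuleCat.{u} R)

/-- The functor `Ξ C = ⨁_{k ≥ 0} C[2k]`. -/
noncomputable def Xi (R : Type u) [CommRing R] :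
    ChainComplex (ModuleCat.{u} R) ℕ ⥤ ChainComplex (ModuleCat.{u} R) ℕ where
  obj C := ∐ fun k : ℕ => (shift R (2 * k)).obj C
  map f := Limits.Sigma.map fun k : ℕ => (shift R (2 * k)).map f

end AbelK

/-! Additivity of `χ_A`: for `0 → A → B → C → 0`, the long exact sequence gives `h_B(n) = h_A(n) +
h_C(n) + (e(n+1) - e(n))`, where `h` is the signed rank sequence and `e(n)` the signed rank of the
connecting map, so `e(0) = 0` and `|e(n)| ≤ |h_C(n)|`. With `E(x) = ∑ e(n) x^n`, the telescoping
part contributes `(1-x)² x⁻¹ E(x)` to the Abel mean, which controlled absolute growth of `h_C` sends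
to `0` (`HasAbelLimit.add_of_telescope`).

The factor `1/2`: the homology series of `ΞC` is the polynomial `p(x) = ∑ h_C(n) x^n` divided by `1
- x²`, so its Abel mean is `p(x)/(1+x)`, with limit `p(1)/2 = χ(C)/2`
(`hasAbelLimit_of_recurrence`).

Injectivity: over a principal ideal domain, every invariant of perfect complexes that is additive
and kills acyclics equals `χ(C)` times its value on `R` (`IsAdditiveInvariant.eq_eulerChar_smul`).
Hence `K₀(R)` is generated by `[R]` and detected by `χ`, and `ξ₀` can be defined by `[R] ↦ [ΞR]`. If
`ξ₀ z = 0`, then `χ(z)/2 = 0`, so `z = 0`. -/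

namespace AbelK

/-! ### Ranks of modules over a domain. -/

section Rank

variable {R : Type u} [CommRing R] [IsDomain R]

/-- Moves rank computations from `Q ⊗ M` to `M` itself, where rank–nullity over a domain applies. -/
lemma rank_eq_finrank (M : Type u) [AddCommGroup M] [Module R M] :
    rank R M = Module.finrank R M :=
  (TensorProduct.isBaseChange R M (FractionRing R)).finrank_eq

lemma finiteRank_iff (M : Type u) [AddCommGroup M] [Module R M] :
    FiniteRank R M ↔ Module.rank R M < Cardinal.aleph0 := by
  rw [FiniteRank, ← Module.rank_lt_aleph0_iff (R := FractionRing R),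
    (TensorProduct.isBaseChange R M (FractionRing R)).rank_eq]

lemma FiniteRank.of_finite (M : Type u) [AddCommGroup M] [Module R M] [Module.Finite R M] :
    FiniteRank R M :=
  (finiteRank_iff M).2 (Module.rank_lt_aleph0 R M)

lemma FiniteRank.of_equiv {M N : Type u} [AddCommGroup M] [Module R M] [AddCommGroup N]
    [Module R N] (e : M ≃ₗ[R] N) (h : FiniteRank R M) : FiniteRank R N := by
  rw [finiteRank_iff] at h ⊢
  rwa [← e.rank_eq]

lemma rank_eq_of_equiv {M N : Type u} [AddCommGroup M] [Module R M] [AddCommGroup N]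
    [Module R N] (e : M ≃ₗ[R] N) : rank R M = rank R N := by
  rw [rank_eq_finrank, rank_eq_finrank, e.finrank_eq]

lemma rank_eq_of_iso {M N : ModuleCat.{u} R} (e : M ≅ N) : rank R M = rank R N :=
  rank_eq_of_equiv e.toLinearEquiv

lemma rank_eq_zero_of_isZero {M : ModuleCat.{u} R} (h : IsZero M) : rank R M = 0 := by
  have := ModuleCat.subsingleton_of_isZero h
  rw [rank_eq_finrank, Module.finrank_zero_of_subsingleton]

lemma rank_pi {ι : Type} [Fintype ι] (M : ι → Type u) [∀ i, AddCommGroup (M i)]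
    [∀ i, Module R (M i)] (h : ∀ i, FiniteRank R (M i)) :
    FiniteRank R (∀ i, M i) ∧ rank R (∀ i, M i) = ∑ i, rank R (M i) := by
  classical
  have h' : ∀ i, Module.Finite (FractionRing R) (FractionRing R ⊗[R] M i) := h
  let e := TensorProduct.piRight R (FractionRing R) (FractionRing R) M
  refine ⟨Module.Finite.equiv e.symm, ?_⟩
  rw [rank, e.finrank_eq, Module.finrank_pi_fintype]
  rfl

/-- The rank of the image of a linear map. -/
noncomputable def imageRank {M N : ModuleCat.{u} R} (f : M ⟶ N) : ℕ :=
  Module.finrank R (LinearMap.range f.hom)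

/-- Rank–nullity for `S.g`, whose kernel is the range of `S.f`. It is an identity of cardinals;
finiteness of the middle term lets it pass to natural numbers. -/
lemma rank_eq_imageRank_add (S : ShortComplex (ModuleCat.{u} R)) (hS : S.Exact)
    (h : FiniteRank R S.X₂) : rank R S.X₂ = imageRank S.f + imageRank S.g := by
  have h1 := LinearMap.rank_range_add_rank_ker S.g.hom
  rw [finiteRank_iff, ← h1] at h
  have h2 := Cardinal.add_lt_aleph0_iff.1 h
  rw [rank_eq_finrank, Module.finrank, ← h1, Cardinal.toNat_add h2.1 h2.2, imageRank, imageRank,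
    hS.moduleCat_range_eq_ker, Module.finrank, Module.finrank, add_comm]

lemma imageRank_le_left {M N : ModuleCat.{u} R} (f : M ⟶ N) (h : FiniteRank R M) :
    imageRank f ≤ rank R M := by
  rw [rank_eq_finrank]
  exact Cardinal.toNat_le_toNat (rank_range_le _) ((finiteRank_iff _).1 h)

lemma rank_shortExact (S : ShortComplex (ModuleCat.{u} R)) (hS : S.ShortExact)
    (h : FiniteRank R S.X₂) : rank R S.X₂ = rank R S.X₁ + rank R S.X₃ := by
  rw [rank_eq_imageRank_add S hS.exact h, rank_eq_finrank, rank_eq_finrank, imageRank, imageRank,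
    LinearMap.finrank_range_of_inj hS.moduleCat_injective_f,
    LinearMap.range_eq_top.2 hS.moduleCat_surjective_g, finrank_top]

end Rank

/-! ### The long exact homology sequence -/

section LongExact

variable {R : Type u} [CommRing R] [IsDomain R]

/-- The alternating ranks `(-1)^n rank δ_n` of the connecting maps `δ_n : H_n C ⟶ H_{n-1} A` of
a short exact sequence, with `δ_0 = 0`. -/
noncomputable def connectingSeq {S : ShortComplex (ChainComplex (ModuleCat.{u} R) ℕ)}
    (hS : S.ShortExact) : ℕ → ℝ
  | 0 => 0
  | n + 1 => (-1) ^ (n + 1) * (imageRank (hS.δ (n + 1) n (by simp)) : ℝ)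

omit [IsDomain R] in
lemma abs_homologySeq (C : ChainComplex (ModuleCat.{u} R) ℕ) (n : ℕ) :
    |homologySeq C n| = rank R (C.homology n) := by
  simp [homologySeq, abs_mul]

variable {S : ShortComplex (ChainComplex (ModuleCat.{u} R) ℕ)} (hS : S.ShortExact)

/-- The source of `δ_n` is `H_n C`. This domination is what lets the growth condition on `C` control
the connecting maps. -/
lemma abs_connectingSeq_le (h : ∀ n, FiniteRank R (S.X₃.homology n)) (n : ℕ) :
    |connectingSeq hS n| ≤ |homologySeq S.X₃ n| := by
  rw [abs_homologySeq]
  cases n with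
  | zero => simp [connectingSeq]
  | succ n =>
    simp only [connectingSeq, abs_mul, abs_pow, abs_neg, abs_one, one_pow, one_mul, Nat.abs_cast]
    exact_mod_cast imageRank_le_left _ (h _)

/-- Exactness splits each homology rank into the ranks of the incoming and outgoing maps. In the
alternating sum the maps induced by `S.f` and `S.g` cancel and only the connecting maps remain. -/
lemma homologySeq_shortExact (h₁ : ∀ n, FiniteRank R (S.X₁.homology n))
    (h₂ : ∀ n, FiniteRank R (S.X₂.homology n)) (h₃ : ∀ n, FiniteRank R (S.X₃.homology n))
    (n : ℕ) : homologySeq S.X₂ n =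
      homologySeq S.X₁ n + homologySeq S.X₃ n + (connectingSeq hS (n + 1) - connectingSeq hS n) := by
  have e₁ := rank_eq_imageRank_add _ (hS.homology_exact₁ (n + 1) n (by simp)) (h₁ n)
  have e₂ := rank_eq_imageRank_add _ (hS.homology_exact₂ n) (h₂ n)
  dsimp only at e₁ e₂
  cases n with
  | zero =>
    -- The long exact sequence ends with a surjection onto `H_0 C`, matching the convention `δ_0 =
    -- 0`.
    have : Epi (HomologicalComplex.homologyMap S.g 0) :=
      have := hS.epi_g
      HomologicalComplex.epi_homologyMap_of_epi_of_not_rel S.g 0 (by simp)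
    have e₃ : rank R (S.X₃.homology 0) = imageRank (HomologicalComplex.homologyMap S.g 0) := by
      rw [rank_eq_finrank, imageRank, LinearMap.range_eq_top.2
        ((ModuleCat.epi_iff_surjective _).1 this), finrank_top]
    simp only [homologySeq, connectingSeq, e₁, e₂, e₃]
    push_cast
    ring
  | succ n =>
    have e₃ := rank_eq_imageRank_add _ (hS.homology_exact₃ (n + 1) n (by simp)) (h₃ (n + 1))
    dsimp only at e₃
    simp only [homologySeq, connectingSeq, e₁, e₂, e₃]
    push_cast
    ring

end LongExact

/-! ### Power series and Abel limits -/

section Series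

lemma RadiusGeOne.summable_abs {a : ℕ → ℝ} (h : RadiusGeOne a) {x : ℝ} (hx0 : 0 ≤ x)
    (hx1 : x < 1) : Summable fun n => |a n| * x ^ n := by
  lift x to NNReal using hx0
  have := (FormalMultilinearSeries.ofScalars ℝ a).summable_norm_mul_pow (r := x)
    (lt_of_lt_of_le (by exact_mod_cast hx1) h)
  simpa [FormalMultilinearSeries.ofScalars_norm] using this

lemma RadiusGeOne.summable {a : ℕ → ℝ} (h : RadiusGeOne a) {x : ℝ} (hx0 : 0 ≤ x)
    (hx1 : x < 1) : Summable fun n => a n * x ^ n := by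
  refine Summable.of_abs ((h.summable_abs hx0 hx1).congr fun n => ?_)
  rw [abs_mul, abs_of_nonneg (pow_nonneg hx0 n)]

lemma radiusGeOne_of_bound {a : ℕ → ℝ} {B : ℝ} (h : ∀ n, |a n| ≤ B) : RadiusGeOne a := by
  refine (FormalMultilinearSeries.ofScalars ℝ a).le_radius_of_bound B (r := 1) fun n => ?_
  simpa [FormalMultilinearSeries.ofScalars_norm] using h n

lemma eventually_mem_Ioo : ∀ᶠ x : ℝ in 𝓝[<] 1, x ∈ Set.Ioo (0 : ℝ) 1 :=
  Ioo_mem_nhdsLT one_pos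

lemma tendsto_one_sub : Tendsto (fun x : ℝ => 1 - x) (𝓝[<] 1) (𝓝 0) := by
  have : Tendsto (fun x : ℝ => 1 - x) (𝓝 1) (𝓝 (1 - 1)) := tendsto_const_nhds.sub tendsto_id
  simpa using this.mono_left nhdsWithin_le_nhds

lemma controlledAbsoluteGrowth_of_bound {a : ℕ → ℝ} {B : ℝ} (h : ∀ n, |a n| ≤ B) :
    ControlledAbsoluteGrowth a := by
  have ha := radiusGeOne_of_bound h
  refine ⟨ha, ?_⟩
  have hB : Tendsto (fun x : ℝ => (1 - x) * B) (𝓝[<] 1) (𝓝 0) := by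
    simpa using tendsto_one_sub.mul_const B
  refine squeeze_zero' ?_ ?_ hB
  · filter_upwards [eventually_mem_Ioo] with x hx
    exact mul_nonneg (sq_nonneg _)
      (tsum_nonneg fun n => mul_nonneg (abs_nonneg _) (pow_nonneg hx.1.le n))
  · filter_upwards [eventually_mem_Ioo] with x hx
    have hle : series (fun k => |a k|) x ≤ B * (1 - x)⁻¹ := by
      rw [← tsum_geometric_of_lt_one hx.1.le hx.2, ← tsum_mul_left]
      exact (ha.summable_abs hx.1.le hx.2).tsum_le_tsum
        (fun n => mul_le_mul_of_nonneg_right (h n) (pow_nonneg hx.1.le n))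
        ((summable_geometric_of_lt_one hx.1.le hx.2).mul_left B)
    have h1 : 0 < 1 - x := by linarith [hx.2]
    calc (1 - x) ^ 2 * series (fun k => |a k|) x ≤ (1 - x) ^ 2 * (B * (1 - x)⁻¹) :=
          mul_le_mul_of_nonneg_left hle (sq_nonneg _)
      _ = (1 - x) * B := by field_simp

lemma HasAbelLimit.unique {a : ℕ → ℝ} {L L' : ℝ} (h : HasAbelLimit a L)
    (h' : HasAbelLimit a L') : L = L' :=
  tendsto_nhds_unique h.2 h'.2

/-- Abel limits are additive up to a difference sequence `e (n + 1) - e n` dominated by a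
sequence of controlled absolute growth. -/
lemma HasAbelLimit.add_of_telescope {a b c e : ℕ → ℝ} {La Lc : ℝ} (ha : HasAbelLimit a La)
    (hc : HasAbelLimit c Lc) (hgc : ControlledAbsoluteGrowth c) (hb : RadiusGeOne b)
    (he0 : e 0 = 0) (hec : ∀ n, |e n| ≤ |c n|)
    (hbe : ∀ n, b n = a n + c n + (e (n + 1) - e n)) : HasAbelLimit b (La + Lc) := by
  refine ⟨hb, ?_⟩
  have hbound : ∀ x ∈ Set.Ioo (0 : ℝ) 1, Summable (fun n => |e n * x ^ n|) ∧
      |series e x| ≤ series (fun k => |c k|) x := by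
    intro x hx
    have hs := hc.1.summable_abs hx.1.le hx.2
    have hle : ∀ n, |e n * x ^ n| ≤ |c n| * x ^ n := fun n => by
      rw [abs_mul, abs_of_nonneg (pow_nonneg hx.1.le n)]
      exact mul_le_mul_of_nonneg_right (hec n) (pow_nonneg hx.1.le n)
    have hse : Summable (fun n => |e n * x ^ n|) :=
      Summable.of_nonneg_of_le (fun n => abs_nonneg _) hle hs
    refine ⟨hse, le_trans ?_ (hse.tsum_le_tsum hle hs)⟩
    exact norm_tsum_le_tsum_norm (f := fun n => e n * x ^ n) hse
  have hE : Tendsto (fun x : ℝ => (1 - x) ^ 2 * series e x) (𝓝[<] 1) (𝓝 0) := by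
    refine squeeze_zero_norm' ?_ hgc.2
    filter_upwards [eventually_mem_Ioo] with x hx
    rw [Real.norm_eq_abs, abs_mul, abs_of_nonneg (sq_nonneg (1 - x))]
    exact mul_le_mul_of_nonneg_left (hbound x hx).2 (sq_nonneg _)
  have hinv : Tendsto (fun x : ℝ => x⁻¹) (𝓝[<] 1) (𝓝 1) := by
    have : Tendsto (fun x : ℝ => x⁻¹) (𝓝 1) (𝓝 (1⁻¹)) := tendsto_inv₀ one_ne_zero
    simpa using this.mono_left nhdsWithin_le_nhds
  -- Since `e 0 = 0`, the differences have series `E/x - E = (1-x)E/x`; one more factor `1 - x`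
  -- gives `(1-x)²E · x⁻¹`.
  have hlim := (ha.2.add hc.2).add (hE.mul hinv)
  rw [zero_mul, add_zero] at hlim
  refine hlim.congr' ?_
  filter_upwards [eventually_mem_Ioo] with x hx
  have sa := ha.1.summable hx.1.le hx.2
  have sc := hc.1.summable hx.1.le hx.2
  have se : Summable fun n => e n * x ^ n := (hbound x hx).1.of_abs
  have se' : Summable fun n => e (n + 1) * x ^ (n + 1) := (summable_nat_add_iff 1).2 se
  have hshift : ∑' n, e (n + 1) * x ^ (n + 1) = series e x := by
    have := se.tsum_eq_zero_add
    rw [series, this, he0]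
    simp
  have hx0 : x ≠ 0 := hx.1.ne'
  have hb' : series b x = series a x + series c x + (series e x * x⁻¹ - series e x) := by
    have h1 : HasSum (fun n => e (n + 1) * x ^ n) (series e x * x⁻¹) := by
      have h := (hshift ▸ se'.hasSum).mul_right x⁻¹
      have hfun : (fun n => e (n + 1) * x ^ (n + 1) * x⁻¹) = fun n => e (n + 1) * x ^ n := by
        funext n
        rw [pow_succ, mul_assoc, mul_assoc, mul_inv_cancel₀ hx0, mul_one]
      rwa [hfun] at h
    refine Eq.trans ?_ ((sa.hasSum.add sc.hasSum).add (h1.sub se.hasSum)).tsum_eq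
    refine tsum_congr fun n => ?_
    rw [hbe]
    ring
  rw [hb']
  field_simp

/-- If `h (n + 2) = h n + a (n + 2)` with the initial terms of `a`, that is, if
`∑ h_n x^n = (∑ a_n x^n) / (1 - x^2)` with `a` finitely supported, then `h` has Abel limit
half of the sum of `a`. -/
lemma hasAbelLimit_of_recurrence {a h : ℕ → ℝ} {N : ℕ} (ha : ∀ n, N ≤ n → a n = 0)
    (h0 : h 0 = a 0) (h1 : h 1 = a 1) (hrec : ∀ n, h (n + 2) = h n + a (n + 2)) :
    HasAbelLimit h ((∑ n ∈ Finset.range N, a n) / 2) ∧ ControlledAbsoluteGrowth h := by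
  -- `h n` is the sum of the `a k` with `k ≤ n` of the parity of `n`. As `a` has finite support, `h`
  -- is bounded, which gives both the radius and the growth condition.
  have hb : ∀ n, |h n| ≤ ∑ k ∈ Finset.range (n + 1), |a k| := by
    intro n
    induction n using Nat.twoStepInduction with
    | zero => simp [h0]
    | one => simp [h1, Finset.sum_range_succ]
    | more n ih _ =>
      rw [hrec, Finset.sum_range_succ, Finset.sum_range_succ]
      linarith [abs_add_le (h n) (a (n + 2)), abs_nonneg (a (n + 1))]
  have hB : ∀ n, |h n| ≤ ∑ k ∈ Finset.range N, |a k| := fun n => (hb n).trans <| by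
    rcases le_total (n + 1) N with hn | hn
    · exact Finset.sum_le_sum_of_subset_of_nonneg (Finset.range_mono hn)
        fun _ _ _ => abs_nonneg _
    · refine (Finset.sum_subset (Finset.range_mono hn) fun k _ hk => ?_).ge
      rw [ha k (by simpa using hk), abs_zero]
  have hr := radiusGeOne_of_bound hB
  refine ⟨⟨hr, ?_⟩, controlledAbsoluteGrowth_of_bound hB⟩
  have hcont : Continuous fun x : ℝ => ∑ n ∈ Finset.range N, a n * x ^ n := by fun_prop
  -- The quotient is `(1-x)` times the series of `h`, because `(1-x)/(1-x²) = 1/(1+x)`.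
  have hlim : Tendsto (fun x : ℝ => (∑ n ∈ Finset.range N, a n * x ^ n) / (1 + x)) (𝓝[<] 1)
      (𝓝 ((∑ n ∈ Finset.range N, a n) / 2)) := by
    have h2 : Tendsto (fun x : ℝ => (∑ n ∈ Finset.range N, a n * x ^ n) / (1 + x)) (𝓝 1)
        (𝓝 ((∑ n ∈ Finset.range N, a n * 1 ^ n) / (1 + 1))) :=
      (hcont.tendsto 1).div (tendsto_const_nhds.add tendsto_id) (by norm_num)
    have h3 := h2.mono_left (nhdsWithin_le_nhds (s := Set.Iio 1))
    norm_num at h3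
    exact h3
  refine hlim.congr' ?_
  filter_upwards [eventually_mem_Ioo] with x hx
  have sh := hr.summable hx.1.le hx.2
  have hsa : HasSum (fun n => a n * x ^ n) (∑ n ∈ Finset.range N, a n * x ^ n) :=
    hasSum_sum_of_ne_finset_zero fun n hn => by rw [ha n (by simpa using hn), zero_mul]
  -- Splitting off two terms of each series turns the recurrence into `(1 - x²)·series h x = ∑ a n *
  -- x ^ n`.
  have e1 := sh.sum_add_tsum_nat_add 2
  have e2 := hsa.summable.sum_add_tsum_nat_add 2
  have e3 : ∑' n, h (n + 2) * x ^ (n + 2) =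
      x ^ 2 * series h x + ∑' n, a (n + 2) * x ^ (n + 2) := by
    rw [series, ← tsum_mul_left, ← (sh.mul_left _).tsum_add ((summable_nat_add_iff 2).2 hsa.summable)]
    refine tsum_congr fun n => ?_
    rw [hrec]
    ring
  rw [hsa.tsum_eq] at e2
  rw [e3] at e1
  simp only [Finset.sum_range_succ, Finset.sum_range_zero, h0, h1] at e1 e2
  have hx1 : 1 + x ≠ 0 := by linarith [hx.1]
  rw [div_eq_iff hx1]
  change _ = series h x at e1
  linear_combination e1 - e2

end Series

/-! ### Homology of locally finite coproducts of complexes. -/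

section Coproduct

variable {R : Type u} [CommRing R]

omit [CommRing R] in
-- Needed because the finite sum in `sum_π_ι` is the identity only in degree `n`, not as a chain
-- map.
lemma homologyMap_eq_of_f_eq {V : Type*} [Category* V] [Abelian V] {ι : Type*}
    {c : ComplexShape ι} {A B : HomologicalComplex V c} {φ ψ : A ⟶ B} {n : ι}
    (h : φ.f n = ψ.f n) :
    HomologicalComplex.homologyMap φ n = HomologicalComplex.homologyMap ψ n := by
  rw [← cancel_epi (A.homologyπ n), ← cancel_mono (B.homologyι n)]
  simp [h]

/-- A sequence of complexes, of which only finitely many are non-zero in each degree. -/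
def LocallyFinite (K : ℕ → ChainComplex (ModuleCat.{u} R) ℕ) : Prop :=
  ∀ k n, n < k → IsZero ((K k).X n)

variable {K : ℕ → ChainComplex (ModuleCat.{u} R) ℕ}

lemma LocallyFinite.sum_π_ι (hK : LocallyFinite K) (n : ℕ) :
    (∑ k ∈ Finset.range (n + 1), Sigma.π K k ≫ Sigma.ι K k).f n = 𝟙 ((∐ K).X n) := by
  -- Evaluation in degree `n` preserves the coproduct, so it suffices to compare on each summand:
  -- for `j ≤ n` only the `j`-th term survives, and for `j > n` the source is zero.
  refine (isColimitOfPreserves (HomologicalComplex.eval _ _ n)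
    (coproductIsCoproduct K)).hom_ext fun ⟨j⟩ => ?_
  change (Sigma.ι K j).f n ≫ _ = (Sigma.ι K j).f n ≫ 𝟙 _
  by_cases hj : j ≤ n
  · rw [← HomologicalComplex.comp_f, Preadditive.comp_sum, Finset.sum_eq_single j]
    · rw [Sigma.ι_π_eq_id_assoc, Category.comp_id]
    · intro k _ hk
      rw [Sigma.ι_π_of_ne_assoc K hk.symm, zero_comp]
    · intro h
      exact absurd (Finset.mem_range.2 (Nat.lt_succ_of_le hj)) h
  · exact (hK j n (not_le.1 hj)).eq_of_src _ _

lemma LocallyFinite.homology_ext (hK : LocallyFinite K) {n : ℕ} (x : (∐ K).homology n) :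
    x = ∑ k ∈ Finset.range (n + 1), HomologicalComplex.homologyMap (Sigma.ι K k) n
      (HomologicalComplex.homologyMap (Sigma.π K k) n x) := by
  have h : HomologicalComplex.homologyMap (∑ k ∈ Finset.range (n + 1),
      Sigma.π K k ≫ Sigma.ι K k) n = 𝟙 _ := by
    rw [← HomologicalComplex.homologyMap_id]
    exact homologyMap_eq_of_f_eq (hK.sum_π_ι n)
  have h' : HomologicalComplex.homologyMap (∑ k ∈ Finset.range (n + 1),
      Sigma.π K k ≫ Sigma.ι K k) n = ∑ k ∈ Finset.range (n + 1),
      HomologicalComplex.homologyMap (Sigma.π K k ≫ Sigma.ι K k) n :=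
    map_sum (HomologicalComplex.homologyFunctor (ModuleCat.{u} R) (ComplexShape.down ℕ) n).mapAddHom _ _
  rw [h'] at h
  have := congr($h x)
  simpa [HomologicalComplex.homologyMap_comp] using this.symm

/-- The homology of a locally finite coproduct in degree `n`. -/
noncomputable def LocallyFinite.homologyEquiv (hK : LocallyFinite K) (n : ℕ) :
    (∐ K).homology n ≃ₗ[R] ∀ k : Fin (n + 1), (K k).homology n :=
  LinearEquiv.ofBijective
    (LinearMap.pi fun k : Fin (n + 1) => (HomologicalComplex.homologyMap (Sigma.π K k) n).hom) <| by
  constructor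
  · rw [← LinearMap.ker_eq_bot, LinearMap.ker_eq_bot']
    intro x hx
    rw [hK.homology_ext x]
    refine Finset.sum_eq_zero fun k hk => ?_
    have : HomologicalComplex.homologyMap (Sigma.π K k) n x = 0 :=
      congrFun hx ⟨k, Finset.mem_range.1 hk⟩
    rw [this, map_zero]
  · intro y
    refine ⟨∑ k : Fin (n + 1), HomologicalComplex.homologyMap (Sigma.ι K k) n (y k), ?_⟩
    ext j
    simp only [LinearMap.pi_apply, map_sum]
    rw [Finset.sum_eq_single j]
    · rw [← ModuleCat.comp_apply, ← HomologicalComplex.homologyMap_comp, Sigma.ι_π_eq_id,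
        HomologicalComplex.homologyMap_id, ModuleCat.id_apply]
    · intro k _ hk
      rw [← ModuleCat.comp_apply, ← HomologicalComplex.homologyMap_comp,
        Sigma.ι_π_of_ne K (fun h => hk (Fin.ext h)), HomologicalComplex.homologyMap_zero]
      rfl
    · simp

end Coproduct

/-! ### Exactness and homology of shifts and of `Ξ`. -/

section Shift

variable {R : Type u} [CommRing R]

instance (m : ℕ) : (shift R m).PreservesZeroMorphisms :=
  inferInstanceAs ((shiftEmbedding m).extendFunctor (ModuleCat.{u} R)).PreservesZeroMorphisms

/-- `C[m]_{n + m} ≅ C_n`. -/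
noncomputable def shiftXIso (m n : ℕ) (C : ChainComplex (ModuleCat.{u} R) ℕ) :
    ((shift R m).obj C).X (n + m) ≅ C.X n :=
  C.extendXIso (shiftEmbedding m) rfl

lemma shift_map_f (m n : ℕ) {C D : ChainComplex (ModuleCat.{u} R) ℕ} (φ : C ⟶ D) :
    ((shift R m).map φ).f (n + m) = (shiftXIso m n C).hom ≫ φ.f n ≫ (shiftXIso m n D).inv :=
  HomologicalComplex.extendMap_f φ (shiftEmbedding m) rfl

lemma isZero_shift_X {m n : ℕ} (h : n < m) (C : ChainComplex (ModuleCat.{u} R) ℕ) :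
    IsZero (((shift R m).obj C).X n) :=
  C.isZero_extend_X (shiftEmbedding m) n fun i (hi : i + m = n) => by omega

/-- `H_{n + m} (C[m]) ≅ H_n C`. -/
noncomputable def shiftHomologyIso (m n : ℕ) (C : ChainComplex (ModuleCat.{u} R) ℕ) :
    ((shift R m).obj C).homology (n + m) ≅ C.homology n :=
  C.extendHomologyIso (shiftEmbedding m) rfl

lemma isZero_shift_homology {m n : ℕ} (h : n < m) (C : ChainComplex (ModuleCat.{u} R) ℕ) :
    IsZero (((shift R m).obj C).homology n) :=
  (C.extend_exactAt (shiftEmbedding m) n fun i (hi : i + m = n) => by omega).isZero_homology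

lemma shift_shortExact (m : ℕ) {S : ShortComplex (ChainComplex (ModuleCat.{u} R) ℕ)}
    (hS : S.ShortExact) : (S.map (shift R m)).ShortExact := by
  refine HomologicalComplex.shortExact_of_degreewise_shortExact _ fun n => ?_
  by_cases hn : n < m
  · exact
      { exact := ShortComplex.exact_of_isZero_X₂ _ (isZero_shift_X hn _)
        mono_f := ⟨fun _ _ _ => (isZero_shift_X hn _).eq_of_tgt _ _⟩
        epi_g := ⟨fun _ _ _ => (isZero_shift_X hn _).eq_of_src _ _⟩ }
  · obtain ⟨n, rfl⟩ := Nat.exists_eq_add_of_le' (not_lt.1 hn)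
    refine ShortComplex.shortExact_of_iso (ShortComplex.isoMk (shiftXIso m n S.X₁).symm
      (shiftXIso m n S.X₂).symm (shiftXIso m n S.X₃).symm ?_ ?_)
      (hS.map_of_exact (HomologicalComplex.eval _ _ n))
    · exact (Iso.inv_comp_eq (shiftXIso m n S.X₁)).2 (shift_map_f m n S.f)
    · exact (Iso.inv_comp_eq (shiftXIso m n S.X₂)).2 (shift_map_f m n S.g)

lemma xi_shortExact {S : ShortComplex (ChainComplex (ModuleCat.{u} R) ℕ)} (hS : S.ShortExact) :
    ∃ w : (Xi R).map S.f ≫ (Xi R).map S.g = 0,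
      (ShortComplex.mk ((Xi R).map S.f) ((Xi R).map S.g) w).ShortExact := by
  let T : ShortComplex (Discrete ℕ ⥤ ChainComplex (ModuleCat.{u} R) ℕ) :=
    ShortComplex.mk (Discrete.natTrans fun k => (shift R (2 * k.as)).map S.f :
        Discrete.functor (fun k : ℕ => (shift R (2 * k)).obj S.X₁) ⟶
          Discrete.functor (fun k : ℕ => (shift R (2 * k)).obj S.X₂))
      (Discrete.natTrans fun k => (shift R (2 * k.as)).map S.g :
        Discrete.functor (fun k : ℕ => (shift R (2 * k)).obj S.X₂) ⟶
          Discrete.functor (fun k : ℕ => (shift R (2 * k)).obj S.X₃))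
      (by
        ext1
        ext1 k
        exact (S.map (shift R (2 * k.as))).zero)
  have hk (k : Discrete ℕ) : (T.map ((evaluation _ _).obj k)).ShortExact :=
    shift_shortExact (2 * k.as) hS
  have hT : T.ShortExact :=
    { exact := by
        rw [ShortComplex.exact_iff_isZero_homology, Functor.isZero_iff]
        exact fun k => ((ShortComplex.exact_iff_isZero_homology _).1 (hk k).exact).of_iso
          (T.mapHomologyIso ((evaluation _ _).obj k)).symm
      mono_f := by
        have (k : Discrete ℕ) : Mono (T.f.app k) := (hk k).mono_f
        exact NatTrans.mono_of_mono_app _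
      epi_g := by
        have (k : Discrete ℕ) : Epi (T.g.app k) := (hk k).epi_g
        exact NatTrans.epi_of_epi_app _ }
  -- `Ξ` is the colimit over a discrete category, and coproducts of complexes of modules are exact.
  exact ⟨_, hT.map_of_exact colim⟩

lemma xi_locallyFinite (C : ChainComplex (ModuleCat.{u} R) ℕ) :
    LocallyFinite fun k => (shift R (2 * k)).obj C :=
  fun k n h => isZero_shift_X (by omega) C

variable [IsDomain R]

lemma rank_shift_homology (m n : ℕ) {C : ChainComplex (ModuleCat.{u} R) ℕ}
    (h : ∀ n, FiniteRank R (C.homology n)) :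
    FiniteRank R (((shift R m).obj C).homology n) ∧
      rank R (((shift R m).obj C).homology n) = if m ≤ n then rank R (C.homology (n - m)) else 0 := by
  split_ifs with hn
  · obtain ⟨n, rfl⟩ := Nat.exists_eq_add_of_le' hn
    rw [Nat.add_sub_cancel]
    exact ⟨(h n).of_equiv (shiftHomologyIso m n C).symm.toLinearEquiv,
      rank_eq_of_iso (shiftHomologyIso m n C)⟩
  · have h0 := isZero_shift_homology (not_le.1 hn) C
    have := ModuleCat.subsingleton_of_isZero h0
    exact ⟨.of_finite _, rank_eq_zero_of_isZero h0⟩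

lemma rank_xi_homology (n : ℕ) {C : ChainComplex (ModuleCat.{u} R) ℕ}
    (h : ∀ n, FiniteRank R (C.homology n)) :
    FiniteRank R (((Xi R).obj C).homology n) ∧
      rank R (((Xi R).obj C).homology n) =
        ∑ k ∈ Finset.range (n + 1), if 2 * k ≤ n then rank R (C.homology (n - 2 * k)) else 0 := by
  let e := (xi_locallyFinite C).homologyEquiv n
  have hp := rank_pi (fun k : Fin (n + 1) => ((shift R (2 * k)).obj C).homology n)
    fun k => (rank_shift_homology _ n h).1
  refine ⟨hp.1.of_equiv e.symm, (rank_eq_of_equiv e).trans (hp.2.trans ?_)⟩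
  rw [← Fin.sum_univ_eq_sum_range (fun k => if 2 * k ≤ n then rank R (C.homology (n - 2 * k)) else 0)]
  exact Finset.sum_congr rfl fun k _ => (rank_shift_homology _ n h).2

lemma homologySeq_xi_zero {C : ChainComplex (ModuleCat.{u} R) ℕ}
    (h : ∀ n, FiniteRank R (C.homology n)) :
    homologySeq ((Xi R).obj C) 0 = homologySeq C 0 := by
  simp [homologySeq, (rank_xi_homology 0 h).2]

lemma homologySeq_xi_one {C : ChainComplex (ModuleCat.{u} R) ℕ}
    (h : ∀ n, FiniteRank R (C.homology n)) :
    homologySeq ((Xi R).obj C) 1 = homologySeq C 1 := by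
  simp [homologySeq, (rank_xi_homology 1 h).2, Finset.sum_range_succ]

/-- Coefficient form of division by `1 - x²`: the summand `k = 0` of `ΞC` contributes `H_{n+2} C`,
and the remaining ones form `(ΞC)[2]`. -/
lemma homologySeq_xi_add_two {C : ChainComplex (ModuleCat.{u} R) ℕ}
    (h : ∀ n, FiniteRank R (C.homology n)) (n : ℕ) :
    homologySeq ((Xi R).obj C) (n + 2) = homologySeq ((Xi R).obj C) n + homologySeq C (n + 2) := by
  have e : rank R (((Xi R).obj C).homology (n + 2)) =
      rank R (((Xi R).obj C).homology n) + rank R (C.homology (n + 2)) := by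
    rw [(rank_xi_homology (n + 2) h).2, (rank_xi_homology n h).2, Finset.sum_range_succ',
      Finset.sum_range_succ]
    -- The index range grows by two while only one summand is new; the last index contributes
    -- nothing.
    have h0 : ¬ 2 * (n + 1 + 1) ≤ n + 2 := by omega
    rw [if_neg h0, add_zero]
    simp only [mul_zero, Nat.zero_le, if_true]
    congr 1
    refine Finset.sum_congr rfl fun k _ => ?_
    have h1 : 2 * (k + 1) ≤ n + 2 ↔ 2 * k ≤ n := by omega
    have h2 : n + 2 - 2 * (k + 1) = n - 2 * k := by omega
    simp only [h1]
    exact if_congr Iff.rfl (congrArg (fun m => rank R (C.homology m)) h2) rfl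
  simp only [homologySeq, e]
  push_cast
  ring

end Shift

/-! ### Perfect complexes: single modules, disks and Euler characteristics. -/

section Perfect

variable {R : Type u} [CommRing R]

lemma perfectComplexes_single (n : ℕ) (M : ModuleCat.{u} R) [Module.Finite R M]
    [Module.Projective R M] :
    perfectComplexes R ((HomologicalComplex.single _ (ComplexShape.down ℕ) n).obj M) := by
  refine ⟨⟨n + 1, fun k hk => HomologicalComplex.isZero_single_obj_X _ _ _ _ (by omega)⟩,
    fun k => ?_⟩
  by_cases hk : k = n
  · subst hk
    let e := (HomologicalComplex.singleObjXSelf (ComplexShape.down ℕ) k M).toLinearEquiv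
    exact ⟨Module.Finite.equiv e.symm, Module.Projective.of_equiv e.symm⟩
  · have := ModuleCat.subsingleton_of_isZero
      (HomologicalComplex.isZero_single_obj_X (ComplexShape.down ℕ) n M k hk)
    exact ⟨inferInstance, inferInstance⟩

lemma perfectComplexes_of_isZero {C : ChainComplex (ModuleCat.{u} R) ℕ}
    (h : ∀ n, IsZero (C.X n)) : perfectComplexes R C := by
  refine ⟨⟨0, fun n _ => h n⟩, fun n => ?_⟩
  have := ModuleCat.subsingleton_of_isZero (h n)
  exact ⟨inferInstance, inferInstance⟩

lemma isZero_homology_of_isZero_X {C : ChainComplex (ModuleCat.{u} R) ℕ} {n : ℕ}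
    (h : IsZero (C.X n)) : IsZero (C.homology n) :=
  (ShortComplex.exact_iff_isZero_homology _).1 (ShortComplex.exact_of_isZero_X₂ _ h)

lemma single_shortExact (n : ℕ) {S : ShortComplex (ModuleCat.{u} R)} (hS : S.ShortExact) :
    (S.map (HomologicalComplex.single _ (ComplexShape.down ℕ) n)).ShortExact :=
  hS.map_of_exact _

/-- The contractible complex `M = M` in degrees `n + 1` and `n`. -/
noncomputable abbrev disk (n : ℕ) (M : ModuleCat.{u} R) : ChainComplex (ModuleCat.{u} R) ℕ :=
  HomologicalComplex.double (𝟙 M) (c := ComplexShape.down ℕ) (i₀ := n + 1) (i₁ := n) (by simp)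

lemma perfectComplexes_disk (n : ℕ) (M : ModuleCat.{u} R) [Module.Finite R M]
    [Module.Projective R M] : perfectComplexes R (disk n M) := by
  refine ⟨⟨n + 2, fun k hk => HomologicalComplex.isZero_double_X _ _ _ (by omega) (by omega)⟩,
    fun k => ?_⟩
  by_cases h1 : k = n + 1
  · subst h1
    let e := (HomologicalComplex.doubleXIso₀ (𝟙 M) (c := ComplexShape.down ℕ) (i₀ := n + 1)
      (i₁ := n) (by simp)).toLinearEquiv
    exact ⟨Module.Finite.equiv e.symm, Module.Projective.of_equiv e.symm⟩
  by_cases h0 : k = n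
  · subst h0
    let e := (HomologicalComplex.doubleXIso₁ (𝟙 M) (c := ComplexShape.down ℕ) (i₀ := k + 1)
      (i₁ := k) (by simp) (by simp)).toLinearEquiv
    exact ⟨Module.Finite.equiv e.symm, Module.Projective.of_equiv e.symm⟩
  · have := ModuleCat.subsingleton_of_isZero (HomologicalComplex.isZero_double_X (𝟙 M)
      (c := ComplexShape.down ℕ) (i₀ := n + 1) (i₁ := n) (by simp) k h1 h0)
    exact ⟨inferInstance, inferInstance⟩

instance isIso_disk_d (n : ℕ) (M : ModuleCat.{u} R) : IsIso ((disk n M).d (n + 1) n) := by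
  rw [HomologicalComplex.double_d (𝟙 M) _ (by simp)]
  infer_instance

lemma isZero_disk_homology (n : ℕ) (M : ModuleCat.{u} R) (k : ℕ) :
    IsZero ((disk n M).homology k) := by
  by_cases h1 : k = n + 1
  · subst h1
    refine ((HomologicalComplex.exactAt_iff' _ (n + 2) (n + 1) n (by simp) (by simp)).2
      ?_).isZero_homology
    refine (ShortComplex.exact_iff_mono _ ?_).2 (inferInstanceAs (Mono ((disk n M).d (n + 1) n)))
    exact HomologicalComplex.double_d_eq_zero₀ (c := ComplexShape.down ℕ) _ (by simp) _ _ (by simp)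
  by_cases h0 : k = n
  · subst h0
    refine ((HomologicalComplex.exactAt_iff' _ (k + 1) k _ (by simp) rfl).2 ?_).isZero_homology
    refine (ShortComplex.exact_iff_epi _ ?_).2 (inferInstanceAs (Epi ((disk k M).d (k + 1) k)))
    exact HomologicalComplex.double_d_eq_zero₀ (c := ComplexShape.down ℕ) _ (by simp) _ _ (by simp)
  · exact isZero_homology_of_isZero_X (HomologicalComplex.isZero_double_X _ _ _ h1 h0)

/-- The short exact sequence `0 ⟶ M[n] ⟶ disk ⟶ M[n + 1] ⟶ 0`. -/
lemma exists_disk_shortExact (n : ℕ) (M : ModuleCat.{u} R) :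
    ∃ (i : (HomologicalComplex.single _ (ComplexShape.down ℕ) n).obj M ⟶ disk n M)
      (p : disk n M ⟶ (HomologicalComplex.single _ (ComplexShape.down ℕ) (n + 1)).obj M)
      (w : i ≫ p = 0), (ShortComplex.mk i p w).ShortExact := by
  let i : (HomologicalComplex.single _ (ComplexShape.down ℕ) n).obj M ⟶ disk n M :=
    HomologicalComplex.mkHomFromSingle
      (HomologicalComplex.doubleXIso₁ (𝟙 M) (c := ComplexShape.down ℕ) (i₀ := n + 1)
        (i₁ := n) (by simp) (by simp)).inv
      fun k _ => by rw [HomologicalComplex.double_d_eq_zero₀ _ _ _ _ (by simp), comp_zero]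
  let p : disk n M ⟶ (HomologicalComplex.single _ (ComplexShape.down ℕ) (n + 1)).obj M :=
    HomologicalComplex.mkHomToSingle
      (HomologicalComplex.doubleXIso₀ (𝟙 M) (c := ComplexShape.down ℕ) (i₀ := n + 1)
        (i₁ := n) (by simp)).hom
      fun k _ => by rw [HomologicalComplex.double_d_eq_zero₁ _ _ _ _ (by simp), zero_comp]
  have hi : IsIso (i.f n) := by
    rw [HomologicalComplex.mkHomFromSingle_f]
    infer_instance
  have hp : IsIso (p.f (n + 1)) := by
    rw [HomologicalComplex.mkHomToSingle_f]
    infer_instance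
  have w : i ≫ p = 0 := by
    apply HomologicalComplex.from_single_hom_ext
    exact (HomologicalComplex.isZero_single_obj_X _ _ _ _ (by simp)).eq_of_tgt _ _
  refine ⟨i, p, w, HomologicalComplex.shortExact_of_degreewise_shortExact _ fun k => ?_⟩
  by_cases h1 : k = n + 1
  · subst h1
    have h0 := HomologicalComplex.isZero_single_obj_X (ComplexShape.down ℕ) n M (n + 1) (by simp)
    exact
      { exact := (ShortComplex.exact_iff_mono _ (h0.eq_of_src _ _)).2
          (inferInstanceAs (Mono (p.f (n + 1))))
        mono_f := ⟨fun _ _ _ => h0.eq_of_tgt _ _⟩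
        epi_g := inferInstanceAs (Epi (p.f (n + 1))) }
  have h0' := HomologicalComplex.isZero_single_obj_X (ComplexShape.down ℕ) (n + 1) M k h1
  by_cases h0 : k = n
  · subst h0
    exact
      { exact := (ShortComplex.exact_iff_epi _ (h0'.eq_of_tgt _ _)).2
          (inferInstanceAs (Epi (i.f k)))
        mono_f := inferInstanceAs (Mono (i.f k))
        epi_g := ⟨fun _ _ _ => h0'.eq_of_src _ _⟩ }
  · have h2 := HomologicalComplex.isZero_single_obj_X (ComplexShape.down ℕ) n M k h0
    have h3 := HomologicalComplex.isZero_double_X (𝟙 M) (c := ComplexShape.down ℕ) (i₀ := n + 1)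
      (i₁ := n) (by simp) k h1 h0
    exact
      { exact := ShortComplex.exact_of_isZero_X₂ _ h3
        mono_f := ⟨fun _ _ _ => h2.eq_of_tgt _ _⟩
        epi_g := ⟨fun _ _ _ => h0'.eq_of_src _ _⟩ }

variable [IsDomain R]

lemma finsum_alternating_eq (r : ℕ → ℕ) {N : ℕ} (h : ∀ n, N ≤ n → r n = 0) :
    ∑ᶠ n : ℕ, (-1) ^ n * (r n : ℤ) = ∑ n ∈ Finset.range N, (-1) ^ n * (r n : ℤ) := by
  refine finsum_eq_sum_of_support_subset _ fun n hn => ?_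
  by_contra hN
  exact hn (by simp [h n (by simpa using hN)])

lemma eulerChar_eq_sum {C : ChainComplex (ModuleCat.{u} R) ℕ} {N : ℕ}
    (h : ∀ n, N ≤ n → IsZero (C.X n)) :
    eulerChar C = ∑ n ∈ Finset.range N, (-1) ^ n * (rank R (C.X n) : ℤ) :=
  finsum_alternating_eq _ fun n hn => rank_eq_zero_of_isZero (h n hn)

lemma homologyEulerChar_eq_sum {C : ChainComplex (ModuleCat.{u} R) ℕ} {N : ℕ}
    (h : ∀ n, N ≤ n → IsZero (C.X n)) :
    homologyEulerChar C = ∑ n ∈ Finset.range N, (-1) ^ n * (rank R (C.homology n) : ℤ) :=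
  finsum_alternating_eq _ fun n hn =>
    rank_eq_zero_of_isZero (isZero_homology_of_isZero_X (h n hn))

lemma eulerChar_single (n : ℕ) (M : ModuleCat.{u} R) :
    eulerChar ((HomologicalComplex.single _ (ComplexShape.down ℕ) n).obj M) =
      (-1) ^ n * (rank R M : ℤ) := by
  rw [eulerChar, finsum_eq_single _ n fun k hk => ?_,
    rank_eq_of_iso (HomologicalComplex.singleObjXSelf (ComplexShape.down ℕ) n M)]
  rw [rank_eq_zero_of_isZero (HomologicalComplex.isZero_single_obj_X _ _ _ _ hk)]
  simp

lemma eulerChar_shortExact {S : ShortComplex (ChainComplex (ModuleCat.{u} R) ℕ)}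
    (hS : S.ShortExact) (h₁ : perfectComplexes R S.X₁) (h₂ : perfectComplexes R S.X₂)
    (h₃ : perfectComplexes R S.X₃) : eulerChar S.X₂ = eulerChar S.X₁ + eulerChar S.X₃ := by
  obtain ⟨N₁, h₁⟩ := h₁.1
  obtain ⟨N₂, hN₂⟩ := h₂.1
  obtain ⟨N₃, h₃⟩ := h₃.1
  rw [eulerChar_eq_sum (N := N₁ + N₂ + N₃) fun n hn => h₁ n (by omega),
    eulerChar_eq_sum (N := N₁ + N₂ + N₃) fun n hn => hN₂ n (by omega),
    eulerChar_eq_sum (N := N₁ + N₂ + N₃) fun n hn => h₃ n (by omega), ← Finset.sum_add_distrib]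
  refine Finset.sum_congr rfl fun n _ => ?_
  have := (h₂.2 n).1
  have hf : FiniteRank R (S.X₂.X n) := .of_finite _
  have e := rank_shortExact _ (hS.map_of_exact (HomologicalComplex.eval _ _ n)) hf
  change rank R (S.X₂.X n) = rank R (S.X₁.X n) + rank R (S.X₃.X n) at e
  rw [e]
  push_cast
  ring

end Perfect

/-! ### The universal property of the Euler characteristic. -/

section Invariant

open scoped ZeroObject

variable {R : Type u} [CommRing R] {G : Type*} [AddCommGroup G]

/-- An invariant of perfect complexes which is additive on short exact sequences and vanishes on
acyclic complexes. -/
structure IsAdditiveInvariant (φ : ∀ C, perfectComplexes R C → G) : Prop where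
  add : ∀ {S : ShortComplex (ChainComplex (ModuleCat.{u} R) ℕ)}, S.ShortExact →
    ∀ h₁ h₂ h₃, φ S.X₂ h₂ = φ S.X₁ h₁ + φ S.X₃ h₃
  acyclic : ∀ {C} (hC : perfectComplexes R C), (∀ n, IsZero (C.homology n)) → φ C hC = 0

variable {φ : ∀ C, perfectComplexes R C → G} (hφ : IsAdditiveInvariant φ)

include hφ

/-- An isomorphism is a monomorphism with quotient the acyclic complex `0`. -/
lemma IsAdditiveInvariant.eq_of_iso {C D : ChainComplex (ModuleCat.{u} R) ℕ} (e : C ≅ D)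
    (hC : perfectComplexes R C) (hD : perfectComplexes R D) : φ C hC = φ D hD := by
  have hz : IsZero (0 : ChainComplex (ModuleCat.{u} R) ℕ) := isZero_zero _
  have hz' (n : ℕ) : IsZero ((0 : ChainComplex (ModuleCat.{u} R) ℕ).X n) :=
    (HomologicalComplex.eval _ _ n).map_isZero hz
  have hS : (ShortComplex.mk e.hom (0 : D ⟶ 0) comp_zero).ShortExact :=
    { exact := (ShortComplex.exact_iff_epi _ rfl).2 (inferInstanceAs (Epi e.hom))
      mono_f := inferInstanceAs (Mono e.hom)
      epi_g := ⟨fun _ _ _ => hz.eq_of_src _ _⟩ }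
  have h0 := perfectComplexes_of_isZero hz'
  rw [hφ.add hS hC hD h0, hφ.acyclic h0 fun n => isZero_homology_of_isZero_X (hz' n), add_zero]

/-- Induction along `0 → R → R^(k+1) → R^k → 0`, which splits off coordinate `0`. -/
lemma IsAdditiveInvariant.single_pi (n k : ℕ) :
    φ _ (perfectComplexes_single n (ModuleCat.of R (Fin k → R))) =
      k • φ _ (perfectComplexes_single n (ModuleCat.of R R)) := by
  induction k with
  | zero =>
    have hz : IsZero (ModuleCat.of R (Fin 0 → R)) := ModuleCat.isZero_of_subsingleton _
    rw [zero_smul]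
    exact hφ.acyclic _ fun m =>
      (HomologicalComplex.homologyFunctor _ _ m).map_isZero (Functor.map_isZero _ hz)
  | succ k ih =>
    let S : ShortComplex (ModuleCat.{u} R) := ShortComplex.moduleCatMk
      (LinearMap.single R (fun _ : Fin (k + 1) => R) 0) (LinearMap.funLeft R R (Fin.succ (n := k)))
      (by
        ext
        simp [LinearMap.funLeft_apply])
    have hS : S.ShortExact :=
      { exact := by
          rw [ShortComplex.moduleCat_exact_iff]
          intro x hx
          refine ⟨(x : Fin (k + 1) → R) 0, ?_⟩
          funext j
          refine Fin.cases ?_ (fun j => ?_) j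
          · exact Pi.single_eq_same (M := fun _ : Fin (k + 1) => R) 0 _
          · exact (Pi.single_eq_of_ne (M := fun _ : Fin (k + 1) => R) (Fin.succ_ne_zero j)
              ((x : Fin (k + 1) → R) 0)).trans
              (congrFun hx j).symm
        mono_f := (ModuleCat.mono_iff_injective _).2
          (Pi.single_injective (M := fun _ : Fin (k + 1) => R) 0)
        epi_g := (ModuleCat.epi_iff_surjective _).2
          (LinearMap.funLeft_surjective_of_injective R R _ (Fin.succ_injective k)) }
    rw [succ_nsmul', ← ih]
    exact hφ.add (single_shortExact n hS) _ _ _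

/-- The disk is an acyclic extension of `R[n+1]` by `R[n]`, so each shift reverses the sign. -/
lemma IsAdditiveInvariant.single_self (n : ℕ) :
    φ _ (perfectComplexes_single n (ModuleCat.of R R)) =
      ((-1) ^ n : ℤ) • φ _ (perfectComplexes_single 0 (ModuleCat.of R R)) := by
  induction n with
  | zero => simp
  | succ n ih =>
    obtain ⟨i, p, w, hS⟩ := exists_disk_shortExact n (ModuleCat.of R R)
    have h := hφ.add hS (perfectComplexes_single _ _) (perfectComplexes_disk _ _)
      (perfectComplexes_single _ _)
    dsimp only at h
    rw [hφ.acyclic _ (isZero_disk_homology n _), ih] at h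
    rw [pow_succ, mul_neg, mul_one, neg_smul]
    exact (neg_eq_of_add_eq_zero_right h.symm).symm

variable [IsDomain R] [IsPrincipalIdealRing R]

/-- Finitely generated projectives over a principal ideal domain are free, which reduces to `R^k`.
-/
lemma IsAdditiveInvariant.single_eq (n : ℕ) (M : ModuleCat.{u} R) [Module.Finite R M]
    [Module.Projective R M] : φ _ (perfectComplexes_single n M) =
      eulerChar ((HomologicalComplex.single _ (ComplexShape.down ℕ) n).obj M) •
        φ _ (perfectComplexes_single 0 (ModuleCat.of R R)) := by
  have : Module.Free R M := inferInstance
  let e : M ≅ ModuleCat.of R (Fin (Module.finrank R M) → R) :=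
    (Module.finBasis R M).equivFun.toModuleIso
  rw [hφ.eq_of_iso ((HomologicalComplex.single _ (ComplexShape.down ℕ) n).mapIso e) _
    (perfectComplexes_single n _), hφ.single_pi, hφ.single_self, eulerChar_single,
    rank_eq_finrank, mul_comm, mul_smul, natCast_zsmul]

/-- The Euler characteristic is the universal additive invariant of perfect complexes over a
principal ideal domain. -/
theorem IsAdditiveInvariant.eq_eulerChar_smul {C : ChainComplex (ModuleCat.{u} R) ℕ}
    (hC : perfectComplexes R C) :
    φ C hC = eulerChar C • φ _ (perfectComplexes_single 0 (ModuleCat.of R R)) := by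
  obtain ⟨N, hN⟩ := hC.1
  induction N generalizing C with
  | zero =>
    have h := eulerChar_eq_sum hN
    rw [Finset.sum_range_zero] at h
    rw [h, zero_smul]
    exact hφ.acyclic _ fun n => isZero_homology_of_isZero_X (hN n (Nat.zero_le n))
  | succ N ih =>
    have := (hC.2 N).1
    have := (hC.2 N).2
    -- Projection onto the top module, a chain map because `C.X (N + 1)` is zero. Its kernel is `C`
    -- truncated to degrees below `N`, to which induction applies.
    let f : C ⟶ (HomologicalComplex.single _ (ComplexShape.down ℕ) N).obj (C.X N) :=
      HomologicalComplex.mkHomToSingle (𝟙 _) fun k hk =>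
        (hN k (by simp at hk; omega)).eq_of_src _ _
    have hf : IsIso (f.f N) := by
      rw [HomologicalComplex.mkHomToSingle_f]
      infer_instance
    have hepi : Epi f := by
      have (k : ℕ) : Epi (f.f k) := by
        by_cases hk : k = N
        · subst hk
          infer_instance
        · exact ⟨fun _ _ _ =>
            (HomologicalComplex.isZero_single_obj_X _ _ _ _ hk).eq_of_src _ _⟩
      exact HomologicalComplex.epi_of_epi_f _ this
    have hS : (ShortComplex.mk (kernel.ι f) f (kernel.condition f)).ShortExact :=
      { exact := ShortComplex.exact_kernel f
        mono_f := inferInstance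
        epi_g := hepi }
    have hm (k : ℕ) : Function.Injective ((kernel.ι f).f k) :=
      (ModuleCat.mono_iff_injective _).1 inferInstance
    have hA : ∀ k, N ≤ k → IsZero ((kernel f).X k) := by
      intro k hk
      rcases hk.eq_or_lt with rfl | hk
      · have h0 : (kernel.ι f).f N = 0 := by
          rw [← cancel_mono (f.f N), ← HomologicalComplex.comp_f, kernel.condition, zero_comp]
          rfl
        exact IsZero.of_mono_eq_zero _ h0
      · exact IsZero.of_mono ((kernel.ι f).f k) (hN k hk)
    have hAp : perfectComplexes R (kernel f) := by
      refine ⟨⟨N, hA⟩, fun k => ?_⟩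
      have := (hC.2 k).1
      have := (hC.2 k).2
      -- Submodules of finitely generated free modules over a principal ideal domain are again
      -- finitely generated and free, so the kernel is perfect.
      have hfin : Module.Finite R ((kernel f).X k) :=
        Module.Finite.of_injective ((kernel.ι f).f k).hom (hm k)
      have : Module.Free R ((kernel f).X k) := Module.Free.of_equiv
        (LinearEquiv.ofInjective ((kernel.ι f).f k).hom (hm k)).symm
      exact ⟨hfin, inferInstance⟩
    have h₁ := hφ.add hS hAp hC (perfectComplexes_single N (C.X N))
    have h₂ := eulerChar_shortExact hS hAp hC (perfectComplexes_single N (C.X N))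
    dsimp only at h₁ h₂
    rw [h₁, h₂, ih hAp hA, hφ.single_eq N (C.X N), add_smul]

end Invariant

/-! ### Relations and universal property of `K₀`. -/

section K0

open scoped ZeroObject

variable {R : Type u} [CommRing R] {P : ObjectProperty (ChainComplex (ModuleCat.{u} R) ℕ)}

lemma K0.cls_add {S : ShortComplex (ChainComplex (ModuleCat.{u} R) ℕ)} (hS : S.ShortExact)
    (h₁ : P S.X₁) (h₂ : P S.X₂) (h₃ : P S.X₃) :
    K0.cls S.X₂ h₂ = K0.cls S.X₁ h₁ + K0.cls S.X₃ h₃ :=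
  (QuotientAddGroup.eq_iff_sub_mem (N := AddSubgroup.closure (k0Relators P))).2
    (AddSubgroup.subset_closure
      (Or.inr ⟨⟨_, h₁⟩, ⟨_, h₂⟩, ⟨_, h₃⟩, S.f, S.g, S.zero, hS, rfl⟩))

lemma K0.cls_eq_of_quasiIso {A B : ChainComplex (ModuleCat.{u} R) ℕ} (f : A ⟶ B) (hf : QuasiIso f)
    (hA : P A) (hB : P B) : K0.cls A hA = K0.cls B hB :=
  (QuotientAddGroup.eq_iff_sub_mem (N := AddSubgroup.closure (k0Relators P))).2
    (AddSubgroup.subset_closure (Or.inl ⟨⟨_, hA⟩, ⟨_, hB⟩, f, hf, rfl⟩))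

/-- An acyclic complex is quasi-isomorphic to `0`, and `[0] = [0] + [0]`. -/
lemma K0.cls_eq_zero {C : ChainComplex (ModuleCat.{u} R) ℕ} (hC : P C)
    (hP : P 0) (h : ∀ n, IsZero (C.homology n)) : K0.cls C hC = 0 := by
  have hz : IsZero (0 : ChainComplex (ModuleCat.{u} R) ℕ) := isZero_zero _
  have hq : QuasiIso (0 : C ⟶ 0) := by
    rw [quasiIso_iff]
    intro n
    rw [quasiIsoAt_iff_isIso_homologyMap]
    exact isIso_of_source_target_iso_zero _ (h n).isoZero
      ((HomologicalComplex.homologyFunctor _ _ n).map_isZero hz).isoZero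
  have hS : (ShortComplex.mk (0 : (0 : ChainComplex (ModuleCat.{u} R) ℕ) ⟶ 0)
      (0 : (0 : ChainComplex (ModuleCat.{u} R) ℕ) ⟶ 0) comp_zero).ShortExact :=
    { exact := ShortComplex.exact_of_isZero_X₂ _ hz
      mono_f := ⟨fun _ _ _ => hz.eq_of_tgt _ _⟩
      epi_g := ⟨fun _ _ _ => hz.eq_of_src _ _⟩ }
  rw [K0.cls_eq_of_quasiIso 0 hq hC hP]
  exact left_eq_add.1 (K0.cls_add hS hP hP hP)

/-- The universal property of `K₀`. -/
def K0.lift {G : Type*} [AddCommGroup G] (φ : ∀ C, P C → G)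
    (hq : ∀ ⦃A B⦄ (f : A ⟶ B), QuasiIso f → ∀ hA hB, φ A hA = φ B hB)
    (hs : ∀ ⦃S : ShortComplex (ChainComplex (ModuleCat.{u} R) ℕ)⦄, S.ShortExact →
      ∀ h₁ h₂ h₃, φ S.X₂ h₂ = φ S.X₁ h₁ + φ S.X₃ h₃) : K0 P →+ G :=
  QuotientAddGroup.lift _ (FreeAbelianGroup.lift fun C : P.FullSubcategory => φ C.obj C.property) <| by
    rw [AddSubgroup.closure_le]
    rintro x (⟨A, B, f, hf, rfl⟩ | ⟨A, B, C, i, p, w, hS, rfl⟩)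
    · simp [hq f hf A.property B.property]
    · simp [hs hS A.property B.property C.property]

lemma K0.lift_cls {G : Type*} [AddCommGroup G] (φ : ∀ C, P C → G)
    (hq : ∀ ⦃A B⦄ (f : A ⟶ B), QuasiIso f → ∀ hA hB, φ A hA = φ B hB)
    (hs : ∀ ⦃S : ShortComplex (ChainComplex (ModuleCat.{u} R) ℕ)⦄, S.ShortExact →
      ∀ h₁ h₂ h₃, φ S.X₂ h₂ = φ S.X₁ h₁ + φ S.X₃ h₃)
    {C : ChainComplex (ModuleCat.{u} R) ℕ} (hC : P C) :
    K0.lift φ hq hs (K0.cls C hC) = φ C hC :=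
  FreeAbelianGroup.lift_apply_of _ _

lemma K0.hom_ext {G : Type*} [AddCommGroup G] {f g : K0 P →+ G}
    (h : ∀ C (hC : P C), f (K0.cls C hC) = g (K0.cls C hC)) : f = g :=
  QuotientAddGroup.addMonoidHom_ext _ (FreeAbelianGroup.lift_ext _ _ fun C => h C.obj C.property)

end K0

/-! ### The homomorphisms `χ_A`, `χ`, `ξ₀` and their composite. -/

section Main

open scoped ZeroObject

variable {R : Type u} [CommRing R] [IsDomain R]

lemma homologySeq_eq_of_quasiIso {A B : ChainComplex (ModuleCat.{u} R) ℕ} (f : A ⟶ B)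
    (hf : QuasiIso f) : homologySeq A = homologySeq B := by
  funext n
  rw [homologySeq, homologySeq, rank_eq_of_iso (asIso (HomologicalComplex.homologyMap f n))]

lemma abelComplexes_of_acyclic {C : ChainComplex (ModuleCat.{u} R) ℕ}
    (h : ∀ n, IsZero (C.homology n)) : abelComplexes R C := by
  have h0 (n : ℕ) : homologySeq C n = 0 := by
    rw [homologySeq, rank_eq_zero_of_isZero (h n), Nat.cast_zero, mul_zero]
  -- The zero sequence satisfies the recurrence trivially, with empty support (`N = 0`).
  have hA := hasAbelLimit_of_recurrence (a := homologySeq C) (h := homologySeq C) (N := 0)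
    (fun n _ => h0 n) rfl rfl fun n => by simp [h0]
  refine ⟨⟨fun n => ?_, _, hA.1⟩, hA.2⟩
  have := ModuleCat.subsingleton_of_isZero (h n)
  exact .of_finite _

lemma HasAbelLimit.shortExact {S : ShortComplex (ChainComplex (ModuleCat.{u} R) ℕ)}
    (hS : S.ShortExact) (h₁ : abelComplexes R S.X₁) (h₂ : abelComplexes R S.X₂)
    (h₃ : abelComplexes R S.X₃) {L₁ L₃ : ℝ} (hL₁ : HasAbelLimit (homologySeq S.X₁) L₁)
    (hL₃ : HasAbelLimit (homologySeq S.X₃) L₃) : HasAbelLimit (homologySeq S.X₂) (L₁ + L₃) :=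
  hL₁.add_of_telescope hL₃ h₃.2 h₂.2.1 (e := connectingSeq hS) rfl
    (abs_connectingSeq_le hS h₃.1.1) (homologySeq_shortExact hS h₁.1.1 h₂.1.1 h₃.1.1)

variable (R) in
/-- The Abel method Euler characteristic as a homomorphism on `K₀ᴬ(R)`. -/
noncomputable def abelChar : K0Abel R →+ ℝ :=
  K0.lift (fun _ hC => hC.1.2.choose)
    (fun _ _ f hf hA hB => hA.1.2.choose_spec.unique
      (by rw [homologySeq_eq_of_quasiIso f hf]; exact hB.1.2.choose_spec))
    (fun _ hS h₁ h₂ h₃ => h₂.1.2.choose_spec.unique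
      (.shortExact hS h₁ h₂ h₃ h₁.1.2.choose_spec h₃.1.2.choose_spec))

lemma hasAbelLimit_abelChar {C : ChainComplex (ModuleCat.{u} R) ℕ} (hC : abelComplexes R C) :
    HasAbelLimit (homologySeq C) (abelChar R (K0.cls C hC)) := by
  rw [abelChar, K0.lift_cls]
  exact hC.1.2.choose_spec

lemma homologyEulerChar_cast {C : ChainComplex (ModuleCat.{u} R) ℕ} {N : ℕ}
    (h : ∀ n, N ≤ n → IsZero (C.X n)) :
    (homologyEulerChar C : ℝ) = ∑ n ∈ Finset.range N, homologySeq C n := by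
  rw [homologyEulerChar_eq_sum h]
  push_cast
  rfl

lemma homologySeq_eq_zero {C : ChainComplex (ModuleCat.{u} R) ℕ} {n : ℕ}
    (h : IsZero (C.X n)) : homologySeq C n = 0 := by
  rw [homologySeq, rank_eq_zero_of_isZero (isZero_homology_of_isZero_X h), Nat.cast_zero, mul_zero]

variable [IsPrincipalIdealRing R]

/-- `R` is Noetherian, so cycles, and hence homology, are finitely generated. -/
lemma finiteRank_homology {C : ChainComplex (ModuleCat.{u} R) ℕ} (hC : perfectComplexes R C)
    (n : ℕ) : FiniteRank R (C.homology n) := by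
  have := (hC.2 n).1
  have : Module.Finite R (C.cycles n) := Module.Finite.of_injective (C.iCycles n).hom
    ((ModuleCat.mono_iff_injective _).1 inferInstance)
  have : Module.Finite R (C.homology n) := Module.Finite.of_surjective (C.homologyπ n).hom
    ((ModuleCat.epi_iff_surjective _).1 inferInstance)
  exact .of_finite _

lemma abelComplexes_xi {C : ChainComplex (ModuleCat.{u} R) ℕ} (hC : perfectComplexes R C) :
    abelComplexes R ((Xi R).obj C) ∧
      HasAbelLimit (homologySeq ((Xi R).obj C)) (homologyEulerChar C / 2) := by
  have hf := finiteRank_homology hC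
  obtain ⟨N, hN⟩ := hC.1
  have h := hasAbelLimit_of_recurrence (N := N) (fun n hn => homologySeq_eq_zero (hN n hn))
    (homologySeq_xi_zero hf) (homologySeq_xi_one hf) (homologySeq_xi_add_two hf)
  rw [← homologyEulerChar_cast hN] at h
  exact ⟨⟨⟨fun n => (rank_xi_homology n hf).1, _, h.1⟩, h.2⟩, h.1⟩

variable (R) in
omit [IsDomain R] [IsPrincipalIdealRing R] in
lemma isAdditiveInvariant_cls :
    IsAdditiveInvariant (R := R) (G := K0Ring R) fun C hC => K0.cls C hC where
  add hS := K0.cls_add hS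
  acyclic hC h := K0.cls_eq_zero hC (perfectComplexes_of_isZero fun n =>
    (HomologicalComplex.eval _ _ n).map_isZero (isZero_zero _)) h

variable (R) in
-- Additivity is the exactness of `Ξ`; acyclicity survives because `H_n(ΞC)` is a finite product of
-- homology modules of shifts of `C`.
lemma isAdditiveInvariant_cls_xi : IsAdditiveInvariant (R := R) (G := K0Abel R) fun C hC =>
    K0.cls ((Xi R).obj C) (abelComplexes_xi hC).1 where
  add hS _ _ _ := K0.cls_add (xi_shortExact hS).2 _ _ _
  acyclic {C} hC h := by
    refine K0.cls_eq_zero _ (abelComplexes_of_acyclic fun n =>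
      (HomologicalComplex.homologyFunctor _ _ n).map_isZero (isZero_zero _)) fun n => ?_
    have hz (m : ℕ) : IsZero (((shift R m).obj C).homology n) := by
      by_cases hn : n < m
      · exact isZero_shift_homology hn C
      · obtain ⟨l, rfl⟩ := Nat.exists_eq_add_of_le' (not_lt.1 hn)
        exact (h l).of_iso (shiftHomologyIso m l C)
    have hk (k : Fin (n + 1)) : Subsingleton (((shift R (2 * (k : ℕ))).obj C).homology n) :=
      ModuleCat.subsingleton_of_isZero (hz _)
    have : Subsingleton (((Xi R).obj C).homology n) := ((xi_locallyFinite C).homologyEquiv n).toEquiv.subsingleton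
    exact ModuleCat.isZero_of_subsingleton _

variable (R) in
lemma isAdditiveInvariant_homologyEulerChar :
    IsAdditiveInvariant (R := R) (G := ℤ) fun C _ => homologyEulerChar C where
  add {S} hS h₁ h₂ h₃ := by
    have hs := homologySeq_shortExact hS (finiteRank_homology h₁) (finiteRank_homology h₂)
      (finiteRank_homology h₃)
    have hle := abs_connectingSeq_le hS (finiteRank_homology h₃)
    obtain ⟨N₁, h₁⟩ := h₁.1
    obtain ⟨N₂, h₂⟩ := h₂.1
    obtain ⟨N₃, h₃⟩ := h₃.1
    -- Summing the long exact sequence identity leaves only the end terms of the telescope: one is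
    -- zero by convention, the other because `H_n` of the quotient vanishes beyond its length.
    have e : connectingSeq hS (N₁ + N₂ + N₃) = 0 := by
      rw [← abs_nonpos_iff, ← abs_zero, ← homologySeq_eq_zero (h₃ (N₁ + N₂ + N₃) (by omega))]
      exact hle _
    have : (homologyEulerChar S.X₂ : ℝ) = homologyEulerChar S.X₁ + homologyEulerChar S.X₃ := by
      rw [homologyEulerChar_cast (N := N₁ + N₂ + N₃) fun n hn => h₁ n (by omega),
        homologyEulerChar_cast (N := N₁ + N₂ + N₃) fun n hn => h₂ n (by omega),
        homologyEulerChar_cast (N := N₁ + N₂ + N₃) fun n hn => h₃ n (by omega),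
        Finset.sum_congr rfl fun n _ => hs n, Finset.sum_add_distrib, Finset.sum_add_distrib,
        Finset.sum_range_sub, e]
      simp [connectingSeq]
    exact_mod_cast this
  acyclic _ h := by
    simp [homologyEulerChar, rank_eq_zero_of_isZero (h _)]

/-- The homological characteristic is itself an additive invariant, with value `1` on `R` in degree
`0`, so universality identifies it with `eulerChar`. -/
lemma eulerChar_eq_homologyEulerChar {C : ChainComplex (ModuleCat.{u} R) ℕ}
    (hC : perfectComplexes R C) : eulerChar C = homologyEulerChar C := by
  have h : homologyEulerChar ((HomologicalComplex.single _ (ComplexShape.down ℕ) 0).obj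
      (ModuleCat.of R R)) = 1 := by
    rw [homologyEulerChar, finsum_eq_single _ 0 fun k hk => ?_, rank_eq_of_iso
      (HomologicalComplex.singleObjHomologySelfIso (ComplexShape.down ℕ) 0 (ModuleCat.of R R)),
      rank_eq_finrank]
    · simp
    · rw [rank_eq_zero_of_isZero (HomologicalComplex.isZero_single_obj_homology _ _ _ _ hk)]
      simp
  rw [(isAdditiveInvariant_homologyEulerChar R).eq_eulerChar_smul hC, h, smul_eq_mul, mul_one]

variable (R) in
/-- The classical Euler characteristic as a homomorphism on `K₀(R)`. -/
noncomputable def classicalChar : K0Ring R →+ ℤ :=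
  K0.lift (fun C _ => eulerChar C)
    (fun _ _ f hf hA hB => by
      -- Invariance under quasi-isomorphism is visible only on the homological side.
      rw [eulerChar_eq_homologyEulerChar hA, eulerChar_eq_homologyEulerChar hB]
      exact finsum_congr fun n => by
        rw [rank_eq_of_iso (asIso (HomologicalComplex.homologyMap f n))])
    (fun _ hS => eulerChar_shortExact hS)

lemma classicalChar_cls {C : ChainComplex (ModuleCat.{u} R) ℕ} (hC : perfectComplexes R C) :
    classicalChar R (K0.cls C hC) = eulerChar C :=
  K0.lift_cls _ _ _ hC

variable (R) in
/-- The map `K₀(R) ⟶ K₀ᴬ(R)` induced by `Ξ`: it sends the generator `[R]` to `[Ξ R]`. -/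
noncomputable def xiHom : K0Ring R →+ K0Abel R :=
  (zmultiplesHom (K0Abel R) (K0.cls _ (abelComplexes_xi
    (perfectComplexes_single 0 (ModuleCat.of R R))).1)).comp (classicalChar R)

/-- Universality applied to `C ↦ [ΞC]`: both sides are `χ(C)·[ΞR]`. Preservation of
quasi-isomorphisms by `Ξ` thus needs no separate check. -/
lemma xiHom_cls {C : ChainComplex (ModuleCat.{u} R) ℕ} (hC : perfectComplexes R C) :
    xiHom R (K0.cls C hC) = K0.cls ((Xi R).obj C) (abelComplexes_xi hC).1 := by
  rw [(isAdditiveInvariant_cls_xi R).eq_eulerChar_smul hC, ← classicalChar_cls hC]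
  rfl

/-- Universality applied to the tautological invariant `C ↦ [C]`; it makes `χ` injective on `K₀(R)`.
-/
lemma eq_classicalChar_smul (z : K0Ring R) :
    z = classicalChar R z • K0.cls _ (perfectComplexes_single 0 (ModuleCat.of R R)) := by
  have h : AddMonoidHom.id (K0Ring R) = (zmultiplesHom (K0Ring R)
      (K0.cls _ (perfectComplexes_single 0 (ModuleCat.of R R)))).comp (classicalChar R) :=
    K0.hom_ext fun C hC => by
      rw [AddMonoidHom.comp_apply, classicalChar_cls]
      exact (isAdditiveInvariant_cls R).eq_eulerChar_smul hC
  exact DFunLike.congr_fun h z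

lemma abelChar_xiHom (z : K0Ring R) : abelChar R (xiHom R z) = (classicalChar R z : ℝ) / 2 := by
  have h : (abelChar R).comp (xiHom R) = (AddMonoidHom.mulRight (2⁻¹ : ℝ)).comp
      ((Int.castAddHom ℝ).comp (classicalChar R)) :=
    K0.hom_ext fun C hC => by
      simp only [AddMonoidHom.comp_apply, xiHom_cls, classicalChar_cls]
      rw [eulerChar_eq_homologyEulerChar hC]
      exact (hasAbelLimit_abelChar _).unique (abelComplexes_xi hC).2
  exact DFunLike.congr_fun h z

variable (R) in
lemma xiHom_injective : Function.Injective (xiHom R) := by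
  refine (injective_iff_map_eq_zero _).2 fun z hz => ?_
  have h := abelChar_xiHom z
  rw [hz, map_zero] at h
  have h0 : classicalChar R z = 0 := by
    have : (classicalChar R z : ℝ) = 0 := by linarith
    exact_mod_cast this
  rw [eq_classicalChar_smul z, h0, zero_smul]

end Main

end AbelK

theorem mainTheorem5 (R : Type u) [CommRing R] [IsDomain R] [IsPrincipalIdealRing R] :
    ∃ (hXi : ∀ C : ChainComplex (ModuleCat.{u} R) ℕ,
          AbelK.perfectComplexes R C → AbelK.abelComplexes R ((AbelK.Xi R).obj C))
      (xi₀ : AbelK.K0Ring R →+ AbelK.K0Abel R)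
      (chiA : AbelK.K0Abel R →+ ℝ)
      (chi : AbelK.K0Ring R →+ ℤ),
      -- `xi₀` is the map induced by the functor `Ξ`
      (∀ (C : ChainComplex (ModuleCat.{u} R) ℕ) (hC : AbelK.perfectComplexes R C),
        xi₀ (AbelK.K0.cls C hC) = AbelK.K0.cls ((AbelK.Xi R).obj C) (hXi C hC)) ∧
      -- `chiA` is the map induced by the Abel method Euler characteristic
      (∀ (C : ChainComplex (ModuleCat.{u} R) ℕ) (hC : AbelK.abelComplexes R C),
        AbelK.HasAbelLimit (AbelK.homologySeq C) (chiA (AbelK.K0.cls C hC))) ∧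
      -- `chi` is the map induced by the classical Euler characteristic
      (∀ (C : ChainComplex (ModuleCat.{u} R) ℕ) (hC : AbelK.perfectComplexes R C),
        chi (AbelK.K0.cls C hC) = AbelK.eulerChar C ∧
        chi (AbelK.K0.cls C hC) = AbelK.homologyEulerChar C) ∧
      (∀ z : AbelK.K0Ring R, chiA (xi₀ z) = (chi z : ℝ) / 2) ∧
      Function.Injective xi₀ :=
  ⟨fun _ hC => (AbelK.abelComplexes_xi hC).1, AbelK.xiHom R, AbelK.abelChar R,
    AbelK.classicalChar R, fun _ hC => AbelK.xiHom_cls hC,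
    fun _ hC => AbelK.hasAbelLimit_abelChar hC,
    fun _ hC => ⟨AbelK.classicalChar_cls hC,
      (AbelK.classicalChar_cls hC).trans (AbelK.eulerChar_eq_homologyEulerChar hC)⟩,
    AbelK.abelChar_xiHom, AbelK.xiHom_injective R⟩
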